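/- Let $n\ge 1$ and let $h:\mathbb{R}^{n+1}\to\mathbb{R}$ be a homogeneous polynomial of degree $3$. A point $p$ with $h(p)>0$ is called a hyperbolic point of $h$ if the bilinear form $-\partial^2h_p$ (minus the flat second derivative of $h$ at $p$) has signature $(n,1)$. An $n$-dimensional closed connected projective special real (CCPSR) manifold is a connected non-empty subset $\mathcal{H}\subset\{h=1\}\subset\mathbb{R}^{n+1}$ that is relatively open in the level set $\{h=1\}$, closed in $\mathbb{R}^{n+1}$, and consists only of hyperbolic points of $h$. Let $U=\mathbb{R}_{>0}\cdot\mathcal{H}$ be the cone spanned by $\mathcal{H}$. The manifold $\mathcal{H}$ is called singular at infinity if there is a point $p\in\partial U\setminus\{0\}$ with $dh_p=0$. It is said to have regular boundary behaviour if (i) $dh_p\neq 0$ for all $p\in\partial U\setminus\{0\}$ (so that $\partial U\setminus\{0\}$ is a smooth hypersurface), and (ii) for all $p\in\partial U\setminus\{0\}$, the restriction of $-\partial^2h_p$ to $T_p(\partial U\setminus\{0\})\times T_p(\partial U\setminus\{0\})$ is positive semidefinite with one-dimensional kernel. **Theorem.** Let $\mathcal{H}\subset\{h=1\}\subset\mathbb{R}^{n+1}$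 be a CCPSR manifold of dimension $n\ge1$. Then $\mathcal{H}$ has regular boundary behaviour if and only if it is not singular at infinity. Moreover, suppose that $\mathcal{H}$ is in standard form, i.e. that linear coordinates $(x,y)\in\mathbb{R}\times\mathbb{R}^n$ on $\mathbb{R}^{n+1}$ have been chosen in which $h=x^3-x\langle y,y\rangle+P_3(y)$, where $P_3$ is a homogeneous cubic polynomial on $\mathbb{R}^n$ and $\langle\cdot,\cdot\rangle$ is the standard Euclidean scalar product on $\mathbb{R}^n$, and $(x,y)=(1,0)\in\mathcal{H}$. Then $\mathcal{H}$ has regular boundary behaviour if and only if $$\max_{\|z\|=1}P_3(z)<\frac{2}{3\sqrt3}.$$ -/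

import Mathlib

open scoped Pointwise RealInnerProductSpace

noncomputable section

namespace PSR

/-- The differential `dh_p` of a polynomial function `h` on `ℝ^m`, through its partial
derivatives. -/
def differential {m : ℕ} (h : MvPolynomial (Fin m) ℝ) (p : Fin m → ℝ) :
    (Fin m → ℝ) →ₗ[ℝ] ℝ :=
  ∑ i, MvPolynomial.eval p (MvPolynomial.pderiv i h) • LinearMap.proj i

/-- The bilinear form `∂²h_p` (the flat second derivative of `h` at `p`), given by the matrix of
second partial derivatives. -/
def hessian {m : ℕ} (h : MvPolynomial (Fin m) ℝ) (p : Fin m → ℝ) :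
    LinearMap.BilinForm ℝ (Fin m → ℝ) :=
  Matrix.toBilin' (Matrix.of fun i j =>
    MvPolynomial.eval p (MvPolynomial.pderiv i (MvPolynomial.pderiv j h)))

/-- `p` is a hyperbolic point of `h`: `h(p) > 0` and `-∂²h_p` has signature `(n, 1)`. -/
def IsHyperbolicPoint {n : ℕ} (h : MvPolynomial (Fin (n + 1)) ℝ) (p : Fin (n + 1) → ℝ) : Prop :=
  0 < MvPolynomial.eval p h ∧
    sigPos (LinearMap.BilinMap.toQuadraticMap (-hessian h p)) = n ∧
    sigNeg (LinearMap.BilinMap.toQuadraticMap (-hessian h p)) = 1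

/-- `H ⊆ {h = 1} ⊆ ℝ^{n+1}` is an `n`-dimensional closed connected projective special real
manifold: `h` is a homogeneous cubic, `H` is a relatively open subset of the level set `{h = 1}`
consisting of hyperbolic points of `h`, connected (so non-empty) and closed in `ℝ^{n+1}`. -/
structure IsCCPSR {n : ℕ} (h : MvPolynomial (Fin (n + 1)) ℝ) (H : Set (Fin (n + 1) → ℝ)) :
    Prop where
  homogeneous : h.IsHomogeneous 3
  isOpen_in_level : ∃ O : Set (Fin (n + 1) → ℝ),
    IsOpen O ∧ H = O ∩ {p | MvPolynomial.eval p h = 1}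
  hyperbolic : ∀ p ∈ H, IsHyperbolicPoint h p
  connected : IsConnected H
  closed : IsClosed H

/-- The cone `U = ℝ_{>0} · H`. -/
def cone {m : ℕ} (H : Set (Fin m → ℝ)) : Set (Fin m → ℝ) := Set.Ioi (0 : ℝ) • H

/-- `∂U \ {0}`. -/
def puncturedBoundary {m : ℕ} (H : Set (Fin m → ℝ)) : Set (Fin m → ℝ) :=
  frontier (cone H) \ {0}

/-- The tangent space at `p` of a subset of `ℝ^m`: the span of the limits of secant directions
at `p`. For a submanifold this is the usual tangent space, as a subspace of `ℝ^m`. -/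
def tangentSpace {m : ℕ} (S : Set (Fin m → ℝ)) (p : Fin m → ℝ) : Submodule ℝ (Fin m → ℝ) :=
  Submodule.span ℝ (tangentConeAt ℝ S p)

/-- `dh_p = 0` for some `p ∈ ∂U \ {0}`. -/
def SingularAtInfinity {m : ℕ} (h : MvPolynomial (Fin m) ℝ) (H : Set (Fin m → ℝ)) : Prop :=
  ∃ p ∈ puncturedBoundary H, differential h p = 0

/-- The form `-∂²h_p` restricted to `T_p(∂U \ {0})`. -/
def boundaryForm {m : ℕ} (h : MvPolynomial (Fin m) ℝ) (H : Set (Fin m → ℝ)) (p : Fin m → ℝ) :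
    LinearMap.BilinForm ℝ (tangentSpace (puncturedBoundary H) p) :=
  (-hessian h p).restrict (tangentSpace (puncturedBoundary H) p)

/-- Regular boundary behaviour. By the first condition (and `h = 0` on `∂U`), `∂U \ {0}` is a
smooth hypersurface; the second one asks that `-∂²h` restricted to its tangent spaces is positive
semidefinite with one-dimensional kernel. -/
structure HasRegularBoundary {m : ℕ} (h : MvPolynomial (Fin m) ℝ) (H : Set (Fin m → ℝ)) :
    Prop where
  differential_ne_zero : ∀ p ∈ puncturedBoundary H, differential h p ≠ 0
  nonneg : ∀ p ∈ puncturedBoundary H, ∀ v, 0 ≤ boundaryForm h H p v v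
  finrank_ker : ∀ p ∈ puncturedBoundary H,
    Module.finrank ℝ (LinearMap.ker (boundaryForm h H p)) = 1

/-- In the linear coordinates `(x, y) ∈ ℝ × ℝ^n` on the ambient space given by `A`, the manifold
`H ⊆ {h = 1}` is in standard form with cubic part `P`: `h = x³ - x⟨y, y⟩ + P(y)` and
`(1, 0) ∈ H`. -/
structure IsStandardForm {n : ℕ} (h : MvPolynomial (Fin (n + 1)) ℝ) (H : Set (Fin (n + 1) → ℝ))
    (A : (ℝ × EuclideanSpace ℝ (Fin n)) ≃ₗ[ℝ] (Fin (n + 1) → ℝ))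
    (P : MvPolynomial (Fin n) ℝ) : Prop where
  homogeneous : P.IsHomogeneous 3
  eval_eq : ∀ (x : ℝ) (y : EuclideanSpace ℝ (Fin n)),
    MvPolynomial.eval (A (x, y)) h = x ^ 3 - x * ⟪y, y⟫ + MvPolynomial.eval (y : Fin n → ℝ) P
  base_mem : A (1, 0) ∈ H

end PSR

end

/-! Everything is expressed through the symmetric trilinear form `polar` of the cubic: `h(p)`,
`dh_p` and `∂²h_p` are `polar` with three, two or one slots filled by `p`, up to the factors 1, 3,
6. The cone `U` over `H` is open, connected, closed in `{h > 0}`, and `∂²h` is negative definite on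
`ker dh` along it (`IsHyperbolicCone`). Hence `h` has no local minimum along a line in `U`, so `U`
is convex, and its closure contains no line.

Suppose `dh ≠ 0` on `∂U \ {0}`. Near a boundary point `p` the closed cone is `{h ≥ 0}`, so the
tangent space is `ker dh_p`, and semidefiniteness passes to the limit from `U`. The kernel contains
`p`. Modulo `p`, any kernel vector can be made a null vector `w` of the full form `∂²h_p`, and then
`h(p + tw) = t³h(w)`. If `h(w) ≠ 0`, the line enters `U` near `p`, at points where `p` violates
negative definiteness. If `h(w) = 0`, the whole line stays in `∂U`, which forces `w = 0`
(`eq_zero_of_polar_eq_zero`).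

In standard form, put `e = (1, 0)`. Since `dh_p ≥ 0` on `U` for `p ∈ ∂U`, `dh_p = 0` is equivalent
to `dh_p(e) = 0`. With `h(p) = 0` this yields a unit `z` with `P(z) = 2/(3√3)`. Conversely this
value makes `1 - t² + P(z)t³` acquire a double root, which is a singular boundary point, while a
larger value contradicts the reverse Cauchy-Schwarz inequality. -/

namespace PSR

open MvPolynomial Filter Topology Set

/-! ### The trilinear form of a cubic -/

section Polarization

variable {m : ℕ} (h : MvPolynomial (Fin m) ℝ)

/-- The symmetric trilinear form whose restriction to the diagonal is the homogeneous cubic `h`. -/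
noncomputable def polar (a b c : Fin m → ℝ) : ℝ :=
  (∑ i, ∑ j, ∑ k, eval 0 (pderiv i (pderiv j (pderiv k h))) * (a i * b j * c k)) / 6

/-- The commutator of two derivations is a derivation, so it vanishes once it vanishes on the
variables. -/
theorem pderiv_pderiv_comm (i j : Fin m) : pderiv i (pderiv j h) = pderiv j (pderiv i h) := by
  have key : ⁅pderiv (R := ℝ) i, pderiv (R := ℝ) j⁆ = 0 := by
    apply MvPolynomial.derivation_ext
    intro k
    classical
    simp only [Derivation.commutator_apply, pderiv_X, Derivation.coe_zero, Pi.zero_apply]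
    by_cases hik : i = k <;> by_cases hjk : j = k <;> simp [hik, hjk]
  have := congrArg (fun D => D h) key
  simpa [Derivation.commutator_apply, sub_eq_zero] using this

theorem polar_swap_left (a b c : Fin m → ℝ) : polar h a b c = polar h b a c := by
  unfold polar
  congr 1
  refine Finset.sum_comm.trans ?_
  refine Finset.sum_congr rfl fun i _ => Finset.sum_congr rfl fun j _ =>
    Finset.sum_congr rfl fun k _ => ?_
  rw [pderiv_pderiv_comm _ j i]
  ring

theorem polar_swap_right (a b c : Fin m → ℝ) : polar h a b c = polar h a c b := by
  unfold polar
  congr 1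
  refine Finset.sum_congr rfl fun i _ => ?_
  refine Finset.sum_comm.trans ?_
  refine Finset.sum_congr rfl fun j _ => Finset.sum_congr rfl fun k _ => ?_
  rw [pderiv_pderiv_comm _ k j]
  ring

theorem polar_add_right (a b c d : Fin m → ℝ) :
    polar h a b (c + d) = polar h a b c + polar h a b d := by
  simp only [polar, Pi.add_apply, mul_add, Finset.sum_add_distrib, add_div]

theorem polar_smul_right (a b c : Fin m → ℝ) (t : ℝ) :
    polar h a b (t • c) = t * polar h a b c := by
  simp only [polar, Pi.smul_apply, smul_eq_mul]
  rw [← mul_div_assoc, Finset.mul_sum]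
  refine congrArg (· / 6) (Finset.sum_congr rfl fun i _ => ?_)
  rw [Finset.mul_sum]
  refine Finset.sum_congr rfl fun j _ => ?_
  rw [Finset.mul_sum]
  exact Finset.sum_congr rfl fun k _ => by ring

theorem polar_add_mid (a b c d : Fin m → ℝ) :
    polar h a (b + c) d = polar h a b d + polar h a c d := by
  rw [polar_swap_right, polar_add_right, polar_swap_right h a d b, polar_swap_right h a d c]

theorem polar_smul_mid (a b c : Fin m → ℝ) (t : ℝ) :
    polar h a (t • b) c = t * polar h a b c := by
  rw [polar_swap_right, polar_smul_right, polar_swap_right]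

theorem polar_add_left (a b c d : Fin m → ℝ) :
    polar h (a + b) c d = polar h a c d + polar h b c d := by
  rw [polar_swap_left, polar_add_mid, polar_swap_left h c a, polar_swap_left h c b]

theorem polar_smul_left (a b c : Fin m → ℝ) (t : ℝ) :
    polar h (t • a) b c = t * polar h a b c := by
  rw [polar_swap_left, polar_smul_mid, polar_swap_left]

@[fun_prop]
theorem Continuous.polar {X : Type*} [TopologicalSpace X] {a b c : X → Fin m → ℝ}
    (ha : Continuous a) (hb : Continuous b) (hc : Continuous c) :
    Continuous fun x => PSR.polar h (a x) (b x) (c x) := by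
  unfold PSR.polar
  fun_prop

/-- Expansion of the cubic along a line. -/
theorem polar_diag_add_smul (p v : Fin m → ℝ) (t : ℝ) :
    polar h (p + t • v) (p + t • v) (p + t • v) =
      polar h p p p + 3 * t * polar h p p v + 3 * t ^ 2 * polar h p v v +
        t ^ 3 * polar h v v v := by
  simp only [polar_add_left, polar_add_mid, polar_add_right, polar_smul_left, polar_smul_mid,
    polar_smul_right]
  rw [polar_swap_right h p v p, polar_swap_left h v p p, polar_swap_right h p v p,
    polar_swap_right h v v p, polar_swap_left h v p v]
  ring

theorem polar_add_smul_sq (p v w : Fin m → ℝ) (t : ℝ) :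
    polar h (p + t • v) (p + t • v) w =
      polar h p p w + 2 * t * polar h p v w + t ^ 2 * polar h v v w := by
  simp only [polar_add_left, polar_add_mid, polar_smul_left, polar_smul_mid]
  rw [polar_swap_left h v p w]
  ring

theorem polar_zero_right (a b : Fin m → ℝ) : polar h a b 0 = 0 := by
  simp [polar]

theorem polar_zero_left (a b : Fin m → ℝ) : polar h 0 a b = 0 := by
  simp [polar]

theorem polar_neg_right (a b c : Fin m → ℝ) : polar h a b (-c) = -polar h a b c := by
  simp [polar, Finset.sum_neg_distrib, neg_div]

theorem polar_neg_diag (a : Fin m → ℝ) : polar h (-a) (-a) (-a) = -polar h a a a := by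
  simp [polar, Finset.sum_neg_distrib, neg_div]

theorem polar_smul_diag (a : Fin m → ℝ) (t : ℝ) :
    polar h (t • a) (t • a) (t • a) = t ^ 3 * polar h a a a := by
  rw [polar_smul_left, polar_smul_mid, polar_smul_right]
  ring

variable {h}

theorem eval_sum_pderiv {k : ℕ} {φ : MvPolynomial (Fin m) ℝ} (hφ : φ.IsHomogeneous k)
    (p : Fin m → ℝ) : ∑ i, p i * eval p (pderiv i φ) = k * eval p φ := by
  have := congrArg (eval p) hφ.sum_X_mul_pderiv
  simpa using this

theorem eval_eq_eval_zero {φ : MvPolynomial (Fin m) ℝ} (hφ : φ.IsHomogeneous 0)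
    (p : Fin m → ℝ) : eval p φ = eval 0 φ := by
  rw [← totalDegree_zero_iff_isHomogeneous, totalDegree_eq_zero_iff_eq_C] at hφ
  rw [hφ]
  simp

/-- Second partials of a cubic are linear forms, so Euler's identity recovers them from the constant
third partials. Two more uses of Euler's identity give `dh` and `h`. -/
theorem hessian_eq_polar (hh : h.IsHomogeneous 3) (p v w : Fin m → ℝ) :
    hessian h p v w = 6 * polar h p v w := by
  have e : ∀ i j, eval p (pderiv i (pderiv j h)) =
      ∑ k, p k * eval 0 (pderiv k (pderiv i (pderiv j h))) := by
    intro i j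
    have h1 : (pderiv i (pderiv j h)).IsHomogeneous 1 := hh.pderiv.pderiv
    have := eval_sum_pderiv h1 p
    rw [Nat.cast_one, one_mul] at this
    rw [← this]
    exact Finset.sum_congr rfl fun k _ => by rw [eval_eq_eval_zero h1.pderiv]
  rw [hessian, Matrix.toBilin'_apply]
  simp only [Matrix.of_apply, e, polar]
  rw [mul_div_cancel₀ _ (by norm_num : (6 : ℝ) ≠ 0)]
  simp only [Finset.mul_sum, Finset.sum_mul]
  symm
  refine Finset.sum_comm.trans (Finset.sum_congr rfl fun i _ => Finset.sum_comm.trans ?_)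
  refine Finset.sum_congr rfl fun j _ => Finset.sum_congr rfl fun k _ => ?_
  ring

theorem differential_eq_polar (hh : h.IsHomogeneous 3) (p v : Fin m → ℝ) :
    differential h p v = 3 * polar h p p v := by
  have h2 := hessian_eq_polar hh p p v
  have e : hessian h p p v = 2 * differential h p v := by
    rw [hessian, Matrix.toBilin'_apply, differential, Finset.sum_comm]
    simp only [Matrix.of_apply, LinearMap.sum_apply, LinearMap.smul_apply, LinearMap.proj_apply,
      smul_eq_mul, Finset.mul_sum]
    refine Finset.sum_congr rfl fun j _ => ?_
    have h1 : (pderiv j h).IsHomogeneous 2 := hh.pderiv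
    have := eval_sum_pderiv h1 p
    push_cast at this
    rw [← mul_assoc, ← this, Finset.sum_mul]
  linarith

theorem eval_eq_polar (hh : h.IsHomogeneous 3) (p : Fin m → ℝ) :
    eval p h = polar h p p p := by
  have h2 := differential_eq_polar hh p p
  have e : differential h p p = 3 * eval p h := by
    have := eval_sum_pderiv hh p
    push_cast at this
    rw [← this, differential]
    simp only [LinearMap.sum_apply, LinearMap.smul_apply, LinearMap.proj_apply, smul_eq_mul]
    exact Finset.sum_congr rfl fun i _ => mul_comm _ _
  linarith

end Polarization

/-! ### Convexity and closure of hyperbolic cones -/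

section HyperbolicCone

variable {m : ℕ}

/-- A connected open cone of hyperbolic points of the cubic `h` that is closed in `{h > 0}`. -/
structure IsHyperbolicCone (h : MvPolynomial (Fin m) ℝ) (U : Set (Fin m → ℝ)) : Prop where
  isOpen : IsOpen U
  connected : IsConnected U
  smul_mem : ∀ {a : ℝ} {x}, 0 < a → x ∈ U → a • x ∈ U
  pos : ∀ {x}, x ∈ U → 0 < polar h x x x
  neg : ∀ {x v}, x ∈ U → v ≠ 0 → polar h x x v = 0 → polar h x v v < 0
  mem_of_closure : ∀ {x}, x ∈ closure U → 0 < polar h x x x → x ∈ U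

variable {h : MvPolynomial (Fin m) ℝ} {U : Set (Fin m → ℝ)}

theorem cubic_nonneg_near_zero {a b c : ℝ}
    (H : ∀ᶠ t in 𝓝 (0 : ℝ), 0 ≤ a * t + b * t ^ 2 + c * t ^ 3) : a = 0 ∧ 0 ≤ b := by
  have hlim : Tendsto (fun t : ℝ => a + b * t + c * t ^ 2) (𝓝 0) (𝓝 a) := by
    have : Continuous fun t : ℝ => a + b * t + c * t ^ 2 := by fun_prop
    simpa using this.tendsto 0
  have h1 : 0 ≤ a := by
    refine ge_of_tendsto (hlim.mono_left (nhdsWithin_le_nhds (s := Ioi 0))) ?_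
    filter_upwards [H.filter_mono nhdsWithin_le_nhds, self_mem_nhdsWithin] with t ht ht0
    refine le_of_mul_le_mul_right ?_ (show (0 : ℝ) < t from ht0)
    linarith
  have h2 : a ≤ 0 := by
    refine le_of_tendsto (hlim.mono_left (nhdsWithin_le_nhds (s := Iio 0))) ?_
    filter_upwards [H.filter_mono nhdsWithin_le_nhds, self_mem_nhdsWithin] with t ht ht0
    refine le_of_mul_le_mul_right ?_ (show 0 < -t from neg_pos.2 ht0)
    linarith
  have h3 : a = 0 := le_antisymm h2 h1
  refine ⟨h3, ?_⟩
  have hlim : Tendsto (fun t : ℝ => b + c * t) (𝓝 0) (𝓝 b) := by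
    have : Continuous fun t : ℝ => b + c * t := by fun_prop
    simpa using this.tendsto 0
  refine ge_of_tendsto (hlim.mono_left (nhdsWithin_le_nhds (s := Ioi 0))) ?_
  filter_upwards [H.filter_mono nhdsWithin_le_nhds, self_mem_nhdsWithin] with t ht ht0
  refine le_of_mul_le_mul_right ?_ (pow_pos (show (0 : ℝ) < t from ht0) 2)
  rw [h3] at ht
  linarith

namespace IsHyperbolicCone

theorem ne_zero (hU : IsHyperbolicCone h U) {x : Fin m → ℝ} (hx : x ∈ U) : x ≠ 0 := by
  rintro rfl
  simpa [polar_zero_left] using hU.pos hx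

theorem neg_semi (hU : IsHyperbolicCone h U) {x v : Fin m → ℝ} (hx : x ∈ U)
    (hv : polar h x x v = 0) : polar h x v v ≤ 0 := by
  by_cases h0 : v = 0
  · simp [h0, polar_zero_right]
  · exact (hU.neg hx h0 hv).le

/-- The cubic has no local minimum along a line through a point of the cone. -/
theorem not_eventually_le (hU : IsHyperbolicCone h U) {r v : Fin m → ℝ} (hr : r ∈ U)
    (hv : v ≠ 0) : ¬ ∀ᶠ t in 𝓝 (0 : ℝ),
      polar h r r r ≤ polar h (r + t • v) (r + t • v) (r + t • v) := by
  intro H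
  have := cubic_nonneg_near_zero (a := 3 * polar h r r v) (b := 3 * polar h r v v)
    (c := polar h v v v) (by
      filter_upwards [H] with t ht
      rw [polar_diag_add_smul] at ht
      linarith)
  have h1 := hU.neg hr hv (by linarith)
  linarith

/-- A minimum over the segment at an interior parameter would be a local minimum of `h` along a
line, so it sits at an endpoint. -/
theorem min_le (hU : IsHyperbolicCone h U) {p q : Fin m → ℝ}
    (hs : segment ℝ p q ⊆ U) {x : Fin m → ℝ} (hx : x ∈ segment ℝ p q) :
    min (polar h p p p) (polar h q q q) ≤ polar h x x x := by
  by_cases hpq : p = q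
  · subst hpq
    simp at hx
    simp [hx]
  rw [segment_eq_image'] at hs hx
  have hc : Continuous fun t : ℝ =>
      polar h (p + t • (q - p)) (p + t • (q - p)) (p + t • (q - p)) := by fun_prop
  obtain ⟨t, ht, hmin⟩ := isCompact_Icc.exists_isMinOn (nonempty_Icc.2 zero_le_one)
    (hc.continuousOn (s := Icc (0 : ℝ) 1))
  rw [isMinOn_iff] at hmin
  obtain ⟨s, hs1, rfl⟩ := hx
  have hst := hmin s hs1
  refine le_trans ?_ hst
  rcases eq_or_lt_of_le ht.1 with h0 | h0
  · simp [← h0]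
  rcases eq_or_lt_of_le ht.2 with h1 | h1
  · simp [h1]
  exfalso
  refine hU.not_eventually_le (hs ⟨t, ht, rfl⟩) (sub_ne_zero.2 (Ne.symm hpq)) ?_
  have : ∀ᶠ τ in 𝓝 (0 : ℝ), t + τ ∈ Icc (0 : ℝ) 1 := by
    have hc : ContinuousAt (fun τ : ℝ => t + τ) 0 := by fun_prop
    exact hc.eventually_mem (by simpa using Icc_mem_nhds h0 h1)
  filter_upwards [this] with τ hτ
  have := hmin _ hτ
  rwa [add_smul, ← add_assoc] at this

/-- Leaving the cone requires passing through a zero of the cubic. -/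
theorem mem_of_preconnected (hU : IsHyperbolicCone h U) {s : Set (Fin m → ℝ)}
    (hs : IsPreconnected s) (hpos : ∀ x ∈ s, 0 < polar h x x x) {q : Fin m → ℝ} (hq : q ∈ s)
    (hqU : q ∈ U) : s ⊆ U :=
  hs.subset_of_closure_inter_subset hU.isOpen ⟨q, hq, hqU⟩
    fun _ hx => hU.mem_of_closure hx.1 (hpos _ hx.2)

/-- Connectedness argument on the points `q` whose segment to `p` stays in `U`. This set is open by
compactness of the segment. It is closed in `U` because `min_le` keeps `h` bounded below by a
positive number on limits of segments. -/
theorem convex (hU : IsHyperbolicCone h U) : Convex ℝ U := by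
  rw [convex_iff_segment_subset]
  intro p hp
  have key : U ⊆ {q | segment ℝ p q ⊆ U} := by
    refine hU.connected.isPreconnected.subset_of_closure_inter_subset ?_ ⟨p, hp, ?_⟩ ?_
    · rw [isOpen_iff_eventually]
      intro q hq
      have : ∀ᶠ y in 𝓝 q, ∀ t ∈ Icc (0 : ℝ) 1, p + t • (y - p) ∈ U := by
        refine isCompact_Icc.eventually_forall_of_forall_eventually fun t ht => ?_
        have hc : Continuous fun z : (Fin m → ℝ) × ℝ => p + z.2 • (z.1 - p) := by fun_prop
        refine hc.continuousAt.eventually_mem (hU.isOpen.mem_nhds (hq ?_))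
        rw [segment_eq_image']
        exact ⟨t, ht, rfl⟩
      filter_upwards [this] with y hy
      rw [segment_eq_image']
      rintro _ ⟨t, ht, rfl⟩
      exact hy t ht
    · simpa using hp
    · rintro q ⟨hq, hqU⟩
      rw [mem_ofPred_eq, segment_eq_image']
      rintro _ ⟨t, ht, rfl⟩
      rw [mem_closure_iff_clusterPt, ClusterPt] at hq
      set F := 𝓝 q ⊓ 𝓟 {q | segment ℝ p q ⊆ U} with hF
      have hmem : ∀ᶠ y in F, segment ℝ p y ⊆ U := mem_inf_of_right (mem_principal_self _)
      have hin : ∀ y, p + t • (y - p) ∈ segment ℝ p y := fun y => by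
        rw [segment_eq_image']
        exact ⟨t, ht, rfl⟩
      have hle : F ≤ 𝓝 q := inf_le_left
      have hc : Continuous fun y => p + t • (y - p) := by fun_prop
      have hlim := (hc.tendsto q).mono_left hle
      refine hU.mem_of_closure (mem_closure_of_tendsto hlim (hmem.mono fun y hy => hy (hin y))) ?_
      have h1 : Continuous fun y =>
          polar h (p + t • (y - p)) (p + t • (y - p)) (p + t • (y - p)) := by fun_prop
      have h2 : Continuous fun y => min (polar h p p p) (polar h y y y) := by fun_prop
      refine (lt_min (hU.pos hp) (hU.pos hqU)).trans_le ?_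
      exact le_of_tendsto_of_tendsto ((h2.tendsto q).mono_left hle) ((h1.tendsto q).mono_left hle)
        (hmem.mono fun y hy => hU.min_le hy (hin y))
  exact fun q hq => key hq

theorem smul_mem_closure (hU : IsHyperbolicCone h U) {a : ℝ} (ha : 0 < a) {x : Fin m → ℝ}
    (hx : x ∈ closure U) : a • x ∈ closure U :=
  map_mem_closure (continuous_const_smul a) hx fun _ hy => hU.smul_mem ha hy

theorem add_mem (hU : IsHyperbolicCone h U) {p q : Fin m → ℝ} (hp : p ∈ closure U)
    (hq : q ∈ U) : p + q ∈ U := by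
  have := hU.convex.combo_closure_interior_mem_interior hp (hU.isOpen.interior_eq.symm ▸ hq)
    (a := 1 / 2) (b := 1 / 2) (by norm_num) (by norm_num) (by norm_num)
  rw [hU.isOpen.interior_eq] at this
  have h2 := hU.smul_mem (a := 2) (by norm_num) this
  rwa [smul_add, smul_smul, smul_smul, mul_one_div_cancel two_ne_zero, one_smul, one_smul] at h2

theorem nonneg (hU : IsHyperbolicCone h U) {p : Fin m → ℝ} (hp : p ∈ closure U) :
    0 ≤ polar h p p p := by
  have hc : Continuous fun x => polar h x x x := by fun_prop
  exact (isClosed_le continuous_const hc).closure_subset_iff.2 (fun x hx => (hU.pos hx).le) hp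

theorem mem_frontier_iff (hU : IsHyperbolicCone h U) {p : Fin m → ℝ} :
    p ∈ frontier U ↔ p ∈ closure U ∧ polar h p p p = 0 := by
  rw [hU.isOpen.frontier_eq, Set.mem_sdiff]
  refine and_congr_right fun hp => ⟨fun hn => ?_, fun h0 hn => (hU.pos hn).ne' h0⟩
  by_contra h0
  exact hn (hU.mem_of_closure hp (lt_of_le_of_ne (hU.nonneg hp) (Ne.symm h0)))

/-- Divide `h(p + tq) > 0` by `t` and let `t` decrease to 0; the constant term `h(p)` is zero. -/
theorem polar_nonneg (hU : IsHyperbolicCone h U) {p q : Fin m → ℝ} (hp : p ∈ frontier U)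
    (hq : q ∈ U) : 0 ≤ polar h p p q := by
  obtain ⟨hpc, hp0⟩ := hU.mem_frontier_iff.1 hp
  have hc : Continuous fun t : ℝ =>
      3 * polar h p p q + 3 * t * polar h p q q + t ^ 2 * polar h q q q := by fun_prop
  have hlim : Tendsto (fun t : ℝ =>
      3 * polar h p p q + 3 * t * polar h p q q + t ^ 2 * polar h q q q) (𝓝[>] 0)
      (𝓝 (3 * polar h p p q)) := by
    simpa using (hc.tendsto 0).mono_left (nhdsWithin_le_nhds (s := Ioi 0))
  have : 0 ≤ 3 * polar h p p q := by
    refine ge_of_tendsto hlim ?_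
    filter_upwards [self_mem_nhdsWithin] with t ht
    have ht : 0 < t := ht
    have := hU.pos (hU.add_mem hpc (hU.smul_mem ht hq))
    rw [polar_diag_add_smul, hp0] at this
    refine le_of_mul_le_mul_right ?_ ht
    linarith
  linarith

/-- At a boundary point the differential is nonnegative on the cone, so that it vanishes as soon
as it vanishes at one point of the cone. -/
theorem polar_eq_zero (hU : IsHyperbolicCone h U) {p q : Fin m → ℝ} (hp : p ∈ frontier U)
    (hq : q ∈ U) (h0 : polar h p p q = 0) (v : Fin m → ℝ) : polar h p p v = 0 := by
  have hc : Continuous fun t : ℝ => q + t • v := by fun_prop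
  have hev : ∀ᶠ t in 𝓝 (0 : ℝ), q + t • v ∈ U :=
    hc.continuousAt.eventually_mem (hU.isOpen.mem_nhds (by simpa using hq))
  refine (cubic_nonneg_near_zero (b := 0) (c := 0) ?_).1
  filter_upwards [hev] with t ht
  have := hU.polar_nonneg hp ht
  rw [polar_add_right, polar_smul_right, h0] at this
  linarith

/-- Near a boundary point with nonzero differential, the closed cone is `{h ≥ 0}`. -/
theorem eventually_mem_closure (hU : IsHyperbolicCone h U) {p u : Fin m → ℝ}
    (hp : p ∈ closure U) (hu : u ∈ U) (hpu : 0 < polar h p p u) :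
    ∀ᶠ x in 𝓝 p, 0 ≤ polar h x x x → x ∈ closure U := by
  have hc : Continuous fun z : (Fin m → ℝ) × ℝ => polar h z.1 z.1 u + z.2 * polar h z.1 u u := by
    fun_prop
  have hev : ∀ᶠ z in 𝓝 p ×ˢ 𝓝 (0 : ℝ), 0 < polar h z.1 z.1 u + z.2 * polar h z.1 u u := by
    rw [← nhds_prod_eq]
    exact hc.continuousAt.eventually_const_lt (by simpa using hpu)
  obtain ⟨A, hA, B, hB, hAB⟩ := eventually_prod_iff.1 hev
  obtain ⟨δ, hδ, hball⟩ := Metric.eventually_nhds_iff_ball.1 hB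
  have hs0 : 0 < δ / 2 := half_pos hδ
  have hcs : Continuous fun x : Fin m → ℝ => x + (δ / 2) • u := by fun_prop
  have hmem : ∀ᶠ x in 𝓝 p, x + (δ / 2) • u ∈ U :=
    hcs.continuousAt.eventually_mem (hU.isOpen.mem_nhds (hU.add_mem hp (hU.smul_mem hs0 hu)))
  filter_upwards [hA, hmem] with x hxA hxU hx0
  -- Moving inward from `x` along `u` keeps `h` positive, and the far end `x + (δ/2)u` lies in `U`;
  -- hence so does the half-open segment, which accumulates at `x`.
  have hpos : ∀ t ∈ Ioc 0 (δ / 2), 0 < polar h (x + t • u) (x + t • u) (x + t • u) := by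
    intro t ht
    have h1 := hAB hxA (hball t (by
      rw [Metric.mem_ball, Real.dist_eq, sub_zero, abs_of_pos ht.1]
      linarith [ht.2]))
    simp only at h1
    rw [polar_diag_add_smul]
    have h2 := mul_pos ht.1 h1
    have h3 := mul_pos (pow_pos ht.1 3) (hU.pos hu)
    linarith
  have hct : Continuous fun t : ℝ => x + t • u := by fun_prop
  have hsub : (fun t : ℝ => x + t • u) '' Ioc 0 (δ / 2) ⊆ U := by
    refine hU.mem_of_preconnected (isPreconnected_Ioc.image _ hct.continuousOn) ?_
      ⟨δ / 2, right_mem_Ioc.2 hs0, rfl⟩ hxU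
    rintro _ ⟨t, ht, rfl⟩
    exact hpos t ht
  have hlim : Tendsto (fun t : ℝ => x + t • u) (𝓝[>] 0) (𝓝 x) := by
    simpa using (hct.tendsto 0).mono_left (nhdsWithin_le_nhds (s := Ioi 0))
  refine mem_closure_of_tendsto hlim ?_
  filter_upwards [Ioc_mem_nhdsGT hs0] with t ht
  exact hsub ⟨t, ht, rfl⟩

/-- The closed cone contains no line. -/
theorem eq_zero_of_neg_mem_closure (hU : IsHyperbolicCone h U) {w : Fin m → ℝ}
    (hw : w ∈ closure U) (hw' : -w ∈ closure U) : w = 0 := by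
  by_contra hne
  have hw0 : polar h w w w = 0 := by
    have h1 := hU.nonneg hw'
    rw [polar_neg_diag] at h1
    linarith [hU.nonneg hw]
  obtain ⟨q, hq⟩ := hU.connected.nonempty
  have hline : ∀ t : ℝ, q + t • w ∈ U := by
    intro t
    rw [add_comm]
    rcases lt_trichotomy t 0 with ht | ht | ht
    · have := hU.add_mem (hU.smul_mem_closure (neg_pos.2 ht) hw') hq
      simpa using this
    · simpa [ht] using hq
    · exact hU.add_mem (hU.smul_mem_closure ht hw) hq
  -- As `h(w) = 0`, the cubic on the line is a quadratic bounded below by 0, which constrains its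
  -- discriminant.
  have hpos : ∀ t : ℝ, 0 ≤ polar h q q q + 3 * t * polar h q q w + 3 * t ^ 2 * polar h q w w := by
    intro t
    have := hU.pos (hline t)
    rw [polar_diag_add_smul, hw0] at this
    linarith
  set a := polar h q q w with ha
  set b := polar h q w w with hb
  have hd := discrim_le_zero (a := 3 * b) (b := 3 * a) (c := polar h q q q) fun t => by
    have := hpos t
    linarith
  rw [discrim] at hd
  have hqq := hU.pos hq
  have hb0 : 0 ≤ b := by
    by_contra hb0
    nlinarith [sq_nonneg a, mul_pos (neg_pos.2 (not_le.1 hb0)) hqq]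
  rcases hb0.eq_or_lt with h0 | h0
  · have : a = 0 := by
      rw [← h0] at hd
      nlinarith [sq_nonneg a]
    have := hU.neg hq hne this
    rw [← hb] at this
    linarith
  -- At this parameter, the vertex of the quadratic, `dh(w) = 0` while `∂²h(w, w)` is positive.
  · have h1 := hU.neg (hline (-(a / (2 * b)))) hne (by
      rw [polar_add_smul_sq, hw0, ← ha, ← hb]
      field_simp
      ring)
    rw [polar_add_left, polar_smul_left, hw0, ← hb] at h1
    linarith

end IsHyperbolicCone

end HyperbolicCone

/-! ### Tangent spaces and second derivative at regular boundary points -/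

section Boundary

variable {m : ℕ} {h : MvPolynomial (Fin m) ℝ} {U : Set (Fin m → ℝ)}

namespace IsHyperbolicCone

theorem exists_polar_pos (hU : IsHyperbolicCone h U) {p v : Fin m → ℝ} (hp : p ∈ frontier U)
    (hv : polar h p p v ≠ 0) : ∃ u ∈ U, 0 < polar h p p u := by
  obtain ⟨u, hu⟩ := hU.connected.nonempty
  refine ⟨u, hu, lt_of_le_of_ne (hU.polar_nonneg hp hu) fun h0 => hv ?_⟩
  exact hU.polar_eq_zero hp hu h0.symm v

/-- If the cubic is regular along the punctured boundary, then its second derivative is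
nondegenerate there. -/
theorem eq_zero_of_polar_eq_zero (hU : IsHyperbolicCone h U)
    (hreg : ∀ x ∈ frontier U, x ≠ 0 → ∃ v, polar h x x v ≠ 0) {p w : Fin m → ℝ}
    (hp : p ∈ frontier U) (hp0 : p ≠ 0) (hw : ∀ v, polar h p w v = 0) : w = 0 := by
  obtain ⟨hpc, hpz⟩ := hU.mem_frontier_iff.1 hp
  obtain ⟨v₀, hv₀⟩ := hreg p hp hp0
  obtain ⟨u, hu, hpu⟩ := hU.exists_polar_pos hp hv₀
  have hppw : polar h p p w = 0 := by rw [polar_swap_right]; exact hw p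
  have hline : ∀ w' : Fin m → ℝ, (∀ v, polar h p w' v = 0) → ∀ t : ℝ,
      polar h (p + t • w') (p + t • w') (p + t • w') = t ^ 3 * polar h w' w' w' := by
    intro w' hw' t
    rw [polar_diag_add_smul, hpz, hw' w', polar_swap_right h p p w', hw' p]
    ring
  have hnot : ∀ w' : Fin m → ℝ, (∀ v, polar h p w' v = 0) → ¬ 0 < polar h w' w' w' := by
    intro w' hw' hpos
    have hc : Continuous fun t : ℝ => p + t • w' := by fun_prop
    have hlim : Tendsto (fun t : ℝ => p + t • w') (𝓝[>] 0) (𝓝 p) := by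
      simpa using (hc.tendsto 0).mono_left (nhdsWithin_le_nhds (s := Ioi 0))
    obtain ⟨t, ht, ht0⟩ := ((hlim.eventually (hU.eventually_mem_closure hpc hu hpu)).and
      self_mem_nhdsWithin).exists
    have ht0 : 0 < t := ht0
    have hq : 0 < polar h (p + t • w') (p + t • w') (p + t • w') := by
      rw [hline w' hw']
      positivity
    have hwwp : polar h w' w' p = 0 := by
      rw [polar_swap_right, polar_swap_left, hw']
    -- Negative definiteness at `p + tw'` is tested on the vector `p`, for which both `dh` and `∂²h`
    -- vanish.
    have h1 := hU.neg (hU.mem_of_closure (ht hq.le) hq) hp0 (by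
      rw [polar_add_smul_sq, hpz, hw' p, hwwp]
      ring)
    rw [polar_add_left, polar_smul_left, hpz, polar_swap_left, hw' p] at h1
    linarith
  have hw0 : polar h w w w = 0 := by
    refine le_antisymm (not_lt.1 (hnot w hw)) ?_
    have := not_lt.1 (hnot (-w) fun v => by
      rw [polar_swap_right, polar_neg_right, polar_swap_right, hw, neg_zero])
    rw [polar_neg_diag] at this
    linarith
  have hz : ∀ t : ℝ, polar h (p + t • w) (p + t • w) (p + t • w) = 0 := fun t => by
    rw [hline w hw, hw0, mul_zero]
  have hct : Continuous fun t : ℝ => p + t • w := by fun_prop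
  -- Openness uses that every point of the line is a nonzero zero of `h`, near which the closed cone
  -- is `{h ≥ 0}`.
  have hclopen : IsClopen ((fun t : ℝ => p + t • w) ⁻¹' closure U) := by
    refine ⟨isClosed_closure.preimage hct, isOpen_iff_eventually.2 fun t ht => ?_⟩
    have hf : p + t • w ∈ frontier U := hU.mem_frontier_iff.2 ⟨ht, hz t⟩
    have hne : p + t • w ≠ 0 := by
      intro h0
      apply hv₀
      have : p = (-t) • w := by rw [neg_smul]; exact eq_neg_of_add_eq_zero_left h0
      calc polar h p p v₀ = polar h p ((-t) • w) v₀ := by rw [← this]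
        _ = 0 := by rw [polar_smul_mid, hw, mul_zero]
    obtain ⟨v, hv⟩ := hreg _ hf hne
    obtain ⟨u', hu', hpu'⟩ := hU.exists_polar_pos hf hv
    filter_upwards [(hct.tendsto t).eventually (hU.eventually_mem_closure ht hu' hpu')] with s hs
    exact hs (hz s).ge
  have huniv : ∀ t : ℝ, p + t • w ∈ closure U := by
    rcases isClopen_iff.1 hclopen with he | he
    · have : (0 : ℝ) ∈ (fun t : ℝ => p + t • w) ⁻¹' closure U := by simpa using hpc
      simp [he] at this
    · intro t
      have := mem_univ t
      rwa [← he] at this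
  have hlim : ∀ w' : Fin m → ℝ, (∀ t : ℝ, p + t • w' ∈ closure U) → w' ∈ closure U := by
    intro w' hw'
    have hc : Continuous fun t : ℝ => t • p + w' := by fun_prop
    have hlim : Tendsto (fun t : ℝ => t • p + w') (𝓝[>] 0) (𝓝 w') := by
      simpa using (hc.tendsto 0).mono_left (nhdsWithin_le_nhds (s := Ioi 0))
    refine isClosed_closure.mem_of_tendsto hlim ?_
    filter_upwards [self_mem_nhdsWithin] with t ht
    have ht : 0 < t := ht
    have := hU.smul_mem_closure ht (hw' t⁻¹)
    rwa [smul_add, smul_inv_smul₀ ht.ne'] at this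
  refine hU.eq_zero_of_neg_mem_closure (hlim w huniv) (hlim (-w) fun t => ?_)
  have := huniv (-t)
  rwa [neg_smul, ← smul_neg] at this

/-- The second derivative is negative semidefinite on the kernel of the differential, also at
regular boundary points. -/
theorem polar_nonpos (hU : IsHyperbolicCone h U) {p u v : Fin m → ℝ} (hp : p ∈ closure U)
    (hu : polar h p p u ≠ 0) (hv : polar h p p v = 0) : polar h p v v ≤ 0 := by
  have hne : ∀ᶠ q in 𝓝 p, polar h q q u ≠ 0 := by
    have hc : Continuous fun q => polar h q q u := by fun_prop
    exact hc.continuousAt.eventually_ne hu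
  -- Projecting `v` along `u` into `ker dh_q` gives vectors on which the form is nonpositive for `q
  -- ∈ U`, and they tend to `v`.
  have hcA : ContinuousAt (fun q => v - (polar h q q v / polar h q q u) • u) p := by
    have h1 : Continuous fun q => polar h q q v := by fun_prop
    have h2 : Continuous fun q => polar h q q u := by fun_prop
    exact continuousAt_const.sub ((h1.continuousAt.div h2.continuousAt hu).smul continuousAt_const)
  have hc : Continuous fun z : (Fin m → ℝ) × (Fin m → ℝ) => polar h z.1 z.2 z.2 := by fun_prop
  have hlim : Tendsto (fun q => polar h q (v - (polar h q q v / polar h q q u) • u)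
      (v - (polar h q q v / polar h q q u) • u)) (𝓝[U] p) (𝓝 (polar h p v v)) := by
    have := (ContinuousAt.comp (f := fun q => (q, v - (polar h q q v / polar h q q u) • u))
      hc.continuousAt (continuousAt_id.prodMk hcA)).tendsto
    simp only [Function.comp_def, hv, zero_div, zero_smul, sub_zero] at this
    exact this.mono_left nhdsWithin_le_nhds
  have := mem_closure_iff_nhdsWithin_neBot.1 hp
  refine le_of_tendsto hlim ?_
  filter_upwards [hne.filter_mono nhdsWithin_le_nhds, self_mem_nhdsWithin] with q hq hqU
  refine hU.neg_semi hqU ?_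
  rw [sub_eq_add_neg, ← neg_smul, polar_add_right, polar_smul_right]
  field_simp
  ring

/-- The tangent cone of the boundary at a regular point is the kernel of the differential. -/
theorem mem_tangentConeAt_iff (hU : IsHyperbolicCone h U) {p u : Fin m → ℝ}
    (hp : p ∈ frontier U) (hp0 : p ≠ 0) (hu : u ∈ U) (hpu : 0 < polar h p p u) (v : Fin m → ℝ) :
    v ∈ tangentConeAt ℝ (frontier U \ {0}) p ↔ polar h p p v = 0 := by
  obtain ⟨hpc, hpz⟩ := hU.mem_frontier_iff.1 hp
  constructor
  · intro hv
    obtain ⟨α, l, hl, c, d, hd, hmem, hcd⟩ := exists_fun_of_mem_tangentConeAt hv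
    -- At `(d, c • d)` this is `c · (h(p + d) - h(p))`, hence 0 when both points lie on the
    -- boundary.
    have hc : Continuous fun z : (Fin m → ℝ) × (Fin m → ℝ) =>
        3 * polar h p p z.2 + 3 * polar h p z.1 z.2 + polar h z.1 z.1 z.2 := by fun_prop
    have hlim := (hc.tendsto (0, v)).comp (hd.prodMk_nhds hcd)
    have h0 : 3 * polar h p p v + 3 * polar h p 0 v + polar h 0 0 v = 0 := by
      refine tendsto_nhds_unique_of_eventuallyEq hlim tendsto_const_nhds ?_
      filter_upwards [hmem] with n hn
      have h1 := (hU.mem_frontier_iff.1 hn.1).2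
      have h2 := polar_diag_add_smul h p (d n) 1
      rw [one_smul, h1, hpz] at h2
      simp only [Function.comp_apply, polar_smul_right]
      linear_combination -(c n) * h2
    rw [polar_zero_left, polar_swap_left h p 0, polar_zero_left] at h0
    linarith
  · intro hv
    rw [tangentConeAt_eq_biInter_closure]
    refine mem_iInter₂.2 fun N hN => Metric.mem_closure_iff.2 fun ε hε => ?_
    have hu0 := norm_pos_iff.2 (hU.ne_zero hu)
    set δ := ε / (2 * ‖u‖) with hδ
    have hδ0 : 0 < δ := by positivity
    -- The expression is `h(p + t(v + su))/t`. For small `t > 0` its sign at `s = ±δ` is that of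
    -- `s`, so some `s` in between gives a boundary point.
    have hsign : ∀ s : ℝ, Tendsto (fun t : ℝ => 3 * polar h p p (v + s • u) +
        3 * t * polar h p (v + s • u) (v + s • u) +
        t ^ 2 * polar h (v + s • u) (v + s • u) (v + s • u)) (𝓝 0)
        (𝓝 (3 * s * polar h p p u)) := by
      intro s
      have hc : Continuous fun t : ℝ => 3 * polar h p p (v + s • u) +
        3 * t * polar h p (v + s • u) (v + s • u) +
        t ^ 2 * polar h (v + s • u) (v + s • u) (v + s • u) := by fun_prop
      have := hc.tendsto 0
      simp only [polar_add_right h p p, polar_smul_right h p p, hv] at this ⊢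
      convert this using 2
      ring
    have hpos := (hsign δ).eventually_const_lt (show 0 < 3 * δ * polar h p p u by positivity)
    have hneg := (hsign (-δ)).eventually_lt_const (show 3 * -δ * polar h p p u < 0 by
      have : 0 < 3 * δ * polar h p p u := by positivity
      linarith)
    have hgood : ∀ᶠ x in 𝓝 (0 : Fin m → ℝ), x ∈ N ∧ p + x ≠ 0 ∧
        (0 ≤ polar h (p + x) (p + x) (p + x) → p + x ∈ closure U) := by
      have hc : Continuous fun x => p + x := by fun_prop
      have ht : Tendsto (fun x => p + x) (𝓝 0) (𝓝 p) := by simpa using hc.tendsto 0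
      exact (eventually_mem_set.2 hN).and ((ht.eventually_ne hp0).and
        (ht.eventually (hU.eventually_mem_closure hpc hu hpu)))
    have hev : ∀ᶠ t in 𝓝 (0 : ℝ), ∀ s ∈ Icc (-δ) δ, t • (v + s • u) ∈ N ∧
        p + t • (v + s • u) ≠ 0 ∧ (0 ≤ polar h (p + t • (v + s • u)) (p + t • (v + s • u))
          (p + t • (v + s • u)) → p + t • (v + s • u) ∈ closure U) := by
      refine isCompact_Icc.eventually_forall_of_forall_eventually fun s _ => ?_
      have hc : Continuous fun z : ℝ × ℝ => z.1 • (v + z.2 • u) := by fun_prop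
      have ht : Tendsto (fun z : ℝ × ℝ => z.1 • (v + z.2 • u)) (𝓝 (0, s)) (𝓝 0) := by
        simpa using hc.tendsto (0, s)
      exact ht.eventually hgood
    obtain ⟨t, ⟨⟨ht1, ht2⟩, ht3⟩, ht0⟩ := (((hpos.and hneg).and hev).filter_mono
      (nhdsWithin_le_nhds (s := Ioi 0)) |>.and self_mem_nhdsWithin).exists
    have ht0 : 0 < t := ht0
    have hfac : ∀ s : ℝ, polar h (p + t • (v + s • u)) (p + t • (v + s • u))
        (p + t • (v + s • u)) = t * (3 * polar h p p (v + s • u) +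
        3 * t * polar h p (v + s • u) (v + s • u) +
        t ^ 2 * polar h (v + s • u) (v + s • u) (v + s • u)) := by
      intro s
      rw [polar_diag_add_smul, hpz]
      ring
    have hcs : Continuous fun s : ℝ => polar h (p + t • (v + s • u)) (p + t • (v + s • u))
        (p + t • (v + s • u)) := by fun_prop
    obtain ⟨s, hs, hs0⟩ := intermediate_value_Icc (by linarith : -δ ≤ δ) hcs.continuousOn
      (show (0 : ℝ) ∈ Icc _ _ from
        ⟨by rw [hfac]; exact (mul_neg_of_pos_of_neg ht0 ht2).le,
          by rw [hfac]; exact (mul_pos ht0 ht1).le⟩)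
    simp only at hs0
    obtain ⟨hsN, hsne, hsU⟩ := ht3 s hs
    refine ⟨v + s • u, ?_, ?_⟩
    · refine mem_smul.2 ⟨t⁻¹, mem_univ _, t • (v + s • u), ⟨hsN, ?_⟩, inv_smul_smul₀ ht0.ne' _⟩
      exact ⟨hU.mem_frontier_iff.2 ⟨hsU hs0.ge, hs0⟩, hsne⟩
    · rw [dist_self_add_right, norm_smul, Real.norm_eq_abs]
      calc |s| * ‖u‖ ≤ δ * ‖u‖ := by gcongr; exact abs_le.2 hs
        _ = ε / 2 := by rw [hδ]; field_simp
        _ < ε := half_lt_self hε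

end IsHyperbolicCone

end Boundary

/-! ### From CCPSR manifolds to hyperbolic cones; regular boundary behaviour -/

section Manifold

variable {n : ℕ} {h : MvPolynomial (Fin (n + 1)) ℝ} {H : Set (Fin (n + 1) → ℝ)}

/-- At a hyperbolic point, the second derivative is negative definite on the kernel of the
differential. -/
theorem IsHyperbolicPoint.polar_neg (hh : h.IsHomogeneous 3) {p v : Fin (n + 1) → ℝ}
    (hp : IsHyperbolicPoint h p) (hv0 : v ≠ 0) (hv : polar h p p v = 0) : polar h p v v < 0 := by
  obtain ⟨hpos, hsig, -⟩ := hp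
  rw [eval_eq_polar hh] at hpos
  by_contra hneg
  rw [not_lt] at hneg
  have hle := QuadraticForm.sigPos_add_finrank_le_of_nonpos
    -- Otherwise `-∂²h_p` is nonpositive on the plane spanned by `p` and `v`, too large beside `n`
    -- positive directions in dimension `n + 1`.
    (Q := LinearMap.BilinMap.toQuadraticMap (-hessian h p)) (V := Submodule.span ℝ {p, v}) (by
      intro x hx
      obtain ⟨a, b, rfl⟩ := Submodule.mem_span_pair.1 hx
      have e : polar h p (a • p + b • v) (a • p + b • v) =
          a ^ 2 * polar h p p p + b ^ 2 * polar h p v v := by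
        simp only [polar_add_mid, polar_add_right, polar_smul_mid, polar_smul_right]
        rw [polar_swap_right h p v p, hv]
        ring
      rw [LinearMap.BilinMap.toQuadraticMap_apply, LinearMap.neg_apply, LinearMap.neg_apply,
        hessian_eq_polar hh, e, neg_nonpos]
      positivity)
  have hli : LinearIndependent ℝ ![p, v] := by
    rw [LinearIndependent.pair_iff]
    intro a b hab
    have h1 : polar h p p (a • p + b • v) = 0 := by rw [hab, polar_zero_right]
    rw [polar_add_right, polar_smul_right, polar_smul_right, hv, mul_zero, add_zero] at h1
    have ha : a = 0 := (mul_eq_zero.1 h1).resolve_right hpos.ne'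
    rw [ha, zero_smul, zero_add] at hab
    exact ⟨ha, (smul_eq_zero.1 hab).resolve_right hv0⟩
  have hfin := finrank_span_eq_card hli
  rw [Matrix.range_cons_cons_empty, Fintype.card_fin] at hfin
  rw [hsig, hfin, Module.finrank_fin_fun] at hle
  omega

namespace IsCCPSR

theorem polar_eq_one (hH : IsCCPSR h H) {q : Fin (n + 1) → ℝ} (hq : q ∈ H) :
    polar h q q q = 1 := by
  obtain ⟨O, -, rfl⟩ := hH.isOpen_in_level
  rw [← eval_eq_polar hH.homogeneous]
  exact hq.2

/-- Since `h(aq) = a³` on the cone, scaling by `h^(-1/3)` is a continuous retraction to `H`, through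
which openness and closedness pass from `H` to the cone. -/
theorem mem_cone_iff (hH : IsCCPSR h H) {x : Fin (n + 1) → ℝ} :
    x ∈ cone H ↔ 0 < polar h x x x ∧ (polar h x x x) ^ (-(1 / 3) : ℝ) • x ∈ H := by
  constructor
  · rintro ⟨a, ha, q, hq, rfl⟩
    have ha : 0 < a := ha
    have e : polar h (a • q) (a • q) (a • q) = a ^ 3 := by
      rw [polar_smul_diag, hH.polar_eq_one hq, mul_one]
    have e2 : (a ^ 3 : ℝ) ^ (-(1 / 3) : ℝ) = a⁻¹ := by
      rw [← Real.rpow_natCast, ← Real.rpow_mul ha.le, ← Real.rpow_neg_one]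
      norm_num
    simp only [e, e2]
    exact ⟨pow_pos ha 3, by rwa [inv_smul_smul₀ ha.ne']⟩
  · rintro ⟨hpos, hmem⟩
    have ha := Real.rpow_pos_of_pos hpos (-(1 / 3))
    exact ⟨_, inv_pos.2 ha, _, hmem, inv_smul_smul₀ ha.ne' x⟩

theorem subset_cone : H ⊆ cone H := fun q hq => ⟨1, mem_Ioi.2 zero_lt_one, q, hq, one_smul _ _⟩

theorem continuousAt_normalize {x : Fin (n + 1) → ℝ} (hx : 0 < polar h x x x) :
    ContinuousAt (fun y => (polar h y y y) ^ (-(1 / 3) : ℝ) • y) x := by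
  have hc : Continuous fun y => polar h y y y := by fun_prop
  exact (hc.continuousAt.rpow_const (Or.inl hx.ne')).smul continuousAt_id

theorem isHyperbolicCone (hH : IsCCPSR h H) : IsHyperbolicCone h (cone H) where
  isOpen := by
    obtain ⟨O, hO, hHO⟩ := hH.isOpen_in_level
    rw [isOpen_iff_eventually]
    intro x hx
    obtain ⟨hpos, hmem⟩ := hH.mem_cone_iff.1 hx
    have hc : Continuous fun y => polar h y y y := by fun_prop
    have hmemO := hmem
    rw [hHO] at hmemO
    filter_upwards [hc.continuousAt.eventually_const_lt hpos,
      (continuousAt_normalize hpos).eventually_mem (hO.mem_nhds hmemO.1)] with y hy hyO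
    refine hH.mem_cone_iff.2 ⟨hy, ?_⟩
    rw [hHO]
    refine ⟨hyO, ?_⟩
    rw [mem_ofPred_eq, eval_eq_polar hH.homogeneous, polar_smul_diag, ← Real.rpow_natCast,
      ← Real.rpow_mul hy.le]
    norm_num
    rw [Real.rpow_neg_one, inv_mul_cancel₀ hy.ne']
  connected := by
    have : cone H = (fun z : ℝ × (Fin (n + 1) → ℝ) => z.1 • z.2) '' (Ioi 0 ×ˢ H) :=
      (image_smul_prod).symm
    rw [this]
    have hc : Continuous fun z : ℝ × (Fin (n + 1) → ℝ) => z.1 • z.2 := by fun_prop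
    exact (isConnected_Ioi.prod hH.connected).image _ hc.continuousOn
  smul_mem := by
    rintro a _ ha ⟨b, hb, q, hq, rfl⟩
    exact ⟨a * b, mul_pos ha hb, q, hq, mul_smul _ _ _⟩
  pos hx := (hH.mem_cone_iff.1 hx).1
  neg := by
    rintro _ v ⟨a, ha, q, hq, rfl⟩ hv0 hv
    have ha : 0 < a := ha
    simp only [polar_smul_left, polar_smul_mid] at hv ⊢
    refine mul_neg_of_pos_of_neg ha
      ((hH.hyperbolic q hq).polar_neg hH.homogeneous hv0 ?_)
    simpa [ha.ne'] using hv
  mem_of_closure := by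
    intro x hx hpos
    refine hH.mem_cone_iff.2 ⟨hpos, ?_⟩
    have := (continuousAt_normalize hpos).continuousWithinAt (s := cone H) |>.mem_closure hx
      (t := H) fun y hy => (hH.mem_cone_iff.1 hy).2
    rwa [hH.closed.closure_eq] at this

theorem not_singularAtInfinity_iff (hH : IsCCPSR h H) : ¬ SingularAtInfinity h H ↔
    ∀ p ∈ frontier (cone H), p ≠ 0 → ∃ v, polar h p p v ≠ 0 := by
  have key : ∀ p, differential h p = 0 ↔ ∀ v, polar h p p v = 0 := by
    intro p
    simp only [LinearMap.ext_iff, differential_eq_polar hH.homogeneous, LinearMap.zero_apply,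
      mul_eq_zero, OfNat.ofNat_ne_zero, false_or]
  simp only [SingularAtInfinity, puncturedBoundary, key, Set.mem_sdiff, mem_singleton_iff]
  push Not
  exact ⟨fun H p hp h0 => H p ⟨hp, h0⟩, fun H p hp => H p hp.1 hp.2⟩

/-- The tangent cone is already the linear space `ker dh_p`, so taking the span adds nothing. -/
theorem mem_tangentSpace_iff (hH : IsCCPSR h H) {p w : Fin (n + 1) → ℝ}
    (hp : p ∈ frontier (cone H)) (hp0 : p ≠ 0) (hw : polar h p p w ≠ 0) (v : Fin (n + 1) → ℝ) :
    v ∈ tangentSpace (puncturedBoundary H) p ↔ polar h p p v = 0 := by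
  have hU := hH.isHyperbolicCone
  obtain ⟨u, hu, hpu⟩ := hU.exists_polar_pos hp hw
  have hset : tangentConeAt ℝ (puncturedBoundary H) p =
      (LinearMap.ker (differential h p) : Set (Fin (n + 1) → ℝ)) := by
    ext v
    rw [puncturedBoundary, hU.mem_tangentConeAt_iff hp hp0 hu hpu, SetLike.mem_coe,
      LinearMap.mem_ker, differential_eq_polar hH.homogeneous]
    simp
  rw [tangentSpace, hset, Submodule.span_eq, LinearMap.mem_ker,
    differential_eq_polar hH.homogeneous]
  simp

theorem boundaryForm_apply (hH : IsCCPSR h H) (p : Fin (n + 1) → ℝ)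
    (v w : tangentSpace (puncturedBoundary H) p) :
    boundaryForm h H p v w = -(6 * polar h p v w) := by
  rw [← hessian_eq_polar hH.homogeneous]
  rfl

theorem hasRegularBoundary_iff (hH : IsCCPSR h H) :
    HasRegularBoundary h H ↔ ¬ SingularAtInfinity h H := by
  refine ⟨fun hr ⟨p, hp, h0⟩ => hr.differential_ne_zero p hp h0, fun hs => ?_⟩
  have hreg := hH.not_singularAtInfinity_iff.1 hs
  have hU := hH.isHyperbolicCone
  refine ⟨fun p hp h0 => hs ⟨p, hp, h0⟩, fun p ⟨hp, hp0⟩ v => ?_, fun p ⟨hp, hp0⟩ => ?_⟩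
  · obtain ⟨w, hw⟩ := hreg p hp hp0
    rw [hH.boundaryForm_apply]
    linarith [hU.polar_nonpos (hU.mem_frontier_iff.1 hp).1 hw
      ((hH.mem_tangentSpace_iff hp hp0 hw v).1 v.2)]
  · obtain ⟨u, hu⟩ := hreg p hp hp0
    have hT := hH.mem_tangentSpace_iff hp hp0 hu
    have hpz := (hU.mem_frontier_iff.1 hp).2
    have hmem : (⟨p, (hT p).2 hpz⟩ : tangentSpace (puncturedBoundary H) p) ∈
        LinearMap.ker (boundaryForm h H p) := by
      refine LinearMap.mem_ker.2 (LinearMap.ext fun v => ?_)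
      rw [hH.boundaryForm_apply, (hT v).1 v.2]
      simp
    have hne : (⟨_, hmem⟩ : LinearMap.ker (boundaryForm h H p)) ≠ 0 := fun h0 => hp0 <| by
      simpa using h0
    refine finrank_eq_one (_ : LinearMap.ker (boundaryForm h H p)) hne ?_
    rintro ⟨⟨w, hwT⟩, hw⟩
    have hw' : ∀ v, polar h p p v = 0 → polar h p w v = 0 := by
      intro v hv
      have := LinearMap.congr_fun (LinearMap.mem_ker.1 hw) ⟨v, (hT v).2 hv⟩
      rw [hH.boundaryForm_apply] at this
      simpa using this
    -- With this `c`, the form `∂²h_p(w - cp, ·)` vanishes on `u` as well as on `ker dh_p`, hence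
    -- everywhere.
    set c := polar h p w u / polar h p p u with hc
    have hz := hU.eq_zero_of_polar_eq_zero hreg hp hp0 (w := w + (-c) • p) fun v => by
      have h1 := hw' (v + (-(polar h p p v / polar h p p u)) • u) (by
        rw [polar_add_right, polar_smul_right]
        field_simp
        ring)
      rw [polar_add_right, polar_smul_right] at h1
      rw [polar_add_mid, polar_smul_mid, hc, ← h1]
      field_simp
    refine ⟨c, Subtype.ext (Subtype.ext ?_)⟩
    change c • p = w
    rw [neg_smul, ← sub_eq_add_neg, sub_eq_zero] at hz
    exact hz.symm

end IsCCPSR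

namespace IsHyperbolicCone

/-- Reverse Cauchy-Schwarz inequality. -/
theorem polar_mul_le_sq {m : ℕ} {h : MvPolynomial (Fin m) ℝ} {U : Set (Fin m → ℝ)}
    (hU : IsHyperbolicCone h U) {q : Fin m → ℝ} (hq : q ∈ U) (v : Fin m → ℝ) :
    polar h q q q * polar h q v v ≤ polar h q q v ^ 2 := by
  have hpos := hU.pos hq
  -- The multiple of `q` is chosen to project `v` into `ker dh_q`.
  have h1 := hU.neg_semi hq (v := v + (-(polar h q q v / polar h q q q)) • q) (by
    rw [polar_add_right, polar_smul_right]
    field_simp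
    ring)
  simp only [polar_add_mid, polar_add_right, polar_smul_mid, polar_smul_right] at h1
  rw [polar_swap_right h q v q] at h1
  have h2 : polar h q v v - polar h q q v ^ 2 / polar h q q q ≤ 0 := by
    convert h1 using 1
    field_simp
    ring
  rw [sub_nonpos, le_div_iff₀ hpos] at h2
  linarith

end IsHyperbolicCone

/-! ### The criterion in standard form -/

namespace IsStandardForm

variable {A : (ℝ × EuclideanSpace ℝ (Fin n)) ≃ₗ[ℝ] (Fin (n + 1) → ℝ)}
  {P : MvPolynomial (Fin n) ℝ}

theorem polar_diag (hS : IsStandardForm h H A P) (hh : h.IsHomogeneous 3) (x : ℝ)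
    (y : EuclideanSpace ℝ (Fin n)) : polar h (A (x, y)) (A (x, y)) (A (x, y)) =
      x ^ 3 - x * ‖y‖ ^ 2 + eval (y : Fin n → ℝ) P := by
  rw [← eval_eq_polar hh, hS.eval_eq, real_inner_self_eq_norm_sq]

/-- The mixed terms are solved from the expansion of `h` along `(1, 0)` at `t = ±1`. -/
theorem polar_base (hS : IsStandardForm h H A P) (hh : h.IsHomogeneous 3) (x : ℝ)
    (y : EuclideanSpace ℝ (Fin n)) :
    polar h (A (x, y)) (A (1, 0)) (A (1, 0)) = x ∧
      polar h (A (x, y)) (A (x, y)) (A (1, 0)) = (3 * x ^ 2 - ‖y‖ ^ 2) / 3 := by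
  have key : ∀ t : ℝ, A (x, y) + t • A (1, 0) = A (x + t, y) := by
    intro t
    rw [← map_smul, ← map_add]
    simp
  have h0 := hS.polar_diag hh x y
  have h1 := polar_diag_add_smul h (A (x, y)) (A (1, 0)) 1
  have h2 := polar_diag_add_smul h (A (x, y)) (A (1, 0)) (-1)
  have h3 := hS.polar_diag hh 1 0
  have h4 := polar_diag_add_smul h (A (1, 0)) (A (1, 0)) 1
  have h5 := hS.polar_diag hh 2 0
  have e5 : A (1, 0) + (1 : ℝ) • A (1, 0) = A (2, 0) := by
    rw [← map_smul, ← map_add]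
    simp [one_add_one_eq_two]
  rw [e5, h5] at h4
  rw [key, hS.polar_diag hh, h0] at h1 h2
  simp only [norm_zero] at h3 h4
  constructor <;> linarith

theorem eval_smul (hS : IsStandardForm h H A P) (hh : h.IsHomogeneous 3) (c : ℝ)
    (y : EuclideanSpace ℝ (Fin n)) :
    eval ((c • y : EuclideanSpace ℝ (Fin n)) : Fin n → ℝ) P =
      c ^ 3 * eval (y : Fin n → ℝ) P := by
  have h1 := hS.polar_diag hh 0 y
  have h2 := hS.polar_diag hh 0 (c • y)
  have e : A (0, c • y) = c • A (0, y) := by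
    rw [← map_smul]
    simp
  rw [e, polar_smul_diag, h1] at h2
  linarith

theorem exists_eval_eq_of_singular (hS : IsStandardForm h H A P) (hH : IsCCPSR h H)
    (hs : SingularAtInfinity h H) :
    ∃ z : EuclideanSpace ℝ (Fin n), ‖z‖ = 1 ∧ eval (z : Fin n → ℝ) P = 2 / (3 * √3) := by
  obtain ⟨p, ⟨hp, hp0⟩, hd⟩ := hs
  have hpz := (hH.isHyperbolicCone.mem_frontier_iff.1 hp).2
  obtain ⟨⟨x, y⟩, rfl⟩ := A.surjective p
  have h1 := differential_eq_polar hH.homogeneous (A (x, y)) (A (1, 0))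
  rw [hd, (hS.polar_base hH.homogeneous x y).2, LinearMap.zero_apply] at h1
  have hy : ‖y‖ ^ 2 = 3 * x ^ 2 := by linarith
  rw [hS.polar_diag hH.homogeneous, hy] at hpz
  have hx : x ≠ 0 := by
    rintro rfl
    have : y = 0 := by simpa using hy
    apply hp0
    simp [this]
  have h3 : (0 : ℝ) < √3 := by positivity
  have h33 : √3 ^ 2 = 3 := Real.sq_sqrt (by norm_num)
  -- `dh_p(1, 0) = 0` gives `‖y‖² = 3x²`, and `h(p) = 0` then gives `P(y) = 2x³`. Dividing by the
  -- signed `√3 x` covers both signs of `x`.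
  refine ⟨(√3 * x)⁻¹ • y, ?_, ?_⟩
  · refine (sq_eq_sq₀ (norm_nonneg _) zero_le_one).1 ?_
    rw [norm_smul, mul_pow, hy, Real.norm_eq_abs, sq_abs, inv_pow, mul_pow, h33]
    field_simp
  · rw [hS.eval_smul hH.homogeneous, show eval (y : Fin n → ℝ) P = 2 * x ^ 3 by linarith,
      inv_pow, mul_pow, show √3 ^ 3 = 3 * √3 by rw [pow_succ, h33]]
    field_simp

theorem singular_of_le_eval (hS : IsStandardForm h H A P) (hH : IsCCPSR h H)
    {z : EuclideanSpace ℝ (Fin n)} (hz : ‖z‖ = 1)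
    (hb : 2 / (3 * √3) ≤ eval (z : Fin n → ℝ) P) : SingularAtInfinity h H := by
  have hU := hH.isHyperbolicCone
  have hh := hH.homogeneous
  have he : A (1, 0) ∈ cone H := IsCCPSR.subset_cone hS.base_mem
  have h3 : (0 : ℝ) < √3 := by positivity
  have h33 : √3 ^ 2 = 3 := Real.sq_sqrt (by norm_num)
  have h333 : √3 ^ 3 = 3 * √3 := by rw [pow_succ, h33]
  set b := eval (z : Fin n → ℝ) P with hbdef
  have hA : ∀ t : ℝ, A (1, 0) + t • A (0, z) = A (1, t • z) := by
    intro t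
    rw [← map_smul, ← map_add]
    simp
  have hline : ∀ t : ℝ, polar h (A (1, t • z)) (A (1, t • z)) (A (1, t • z)) =
      1 - t ^ 2 + b * t ^ 3 := by
    intro t
    rw [hS.polar_diag hh, hS.eval_smul hh, norm_smul, hz, Real.norm_eq_abs, mul_one, sq_abs]
    ring
  have hct : Continuous fun t : ℝ => A (1, t • z) := by
    simp only [← hA]
    fun_prop
  have hmem : ∀ s : Set ℝ, IsPreconnected s → 0 ∈ s → (∀ t ∈ s, 0 < 1 - t ^ 2 + b * t ^ 3) →
      ∀ t ∈ s, A (1, t • z) ∈ cone H := by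
    intro s hs h0 hpos t ht
    refine hU.mem_of_preconnected (hs.image _ hct.continuousOn) ?_ (q := A (1, 0))
      ⟨0, h0, by simp⟩ he ⟨t, ht, rfl⟩
    rintro _ ⟨t, ht, rfl⟩
    rw [hline]
    exact hpos t ht
  -- At the critical value the cubic has a double root at `√3` and no other nonnegative root.
  have hfac : ∀ t : ℝ, 1 - t ^ 2 + 2 / (3 * √3) * t ^ 3 =
      2 / (3 * √3) * ((t - √3) ^ 2 * (t + √3 / 2)) := by
    intro t
    field_simp
    linear_combination -h333
  rcases hb.eq_or_lt with hb | hb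
  · have hin := hmem (Ico 0 √3) isPreconnected_Ico (left_mem_Ico.2 h3) fun t ht => by
      rw [← hb, hfac]
      have h1 : 0 < (t - √3) ^ 2 := by
        have := sub_ne_zero.2 ht.2.ne
        positivity
      have h2 : 0 < t + √3 / 2 := by linarith [ht.1]
      positivity
    have hcl : A (1, √3 • z) ∈ closure (cone H) := by
      have hlim := (hct.tendsto √3).mono_left (nhdsWithin_le_nhds (s := Iio √3))
      refine mem_closure_of_tendsto hlim ?_
      filter_upwards [Ico_mem_nhdsLT h3] with t ht
      exact hin t ht
    have hfr : A (1, √3 • z) ∈ frontier (cone H) := by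
      refine hU.mem_frontier_iff.2 ⟨hcl, ?_⟩
      rw [hline, ← hb, hfac]
      simp
    refine ⟨A (1, √3 • z), ⟨hfr, by simp⟩, LinearMap.ext fun v => ?_⟩
    rw [differential_eq_polar hh, hU.polar_eq_zero hfr he, mul_zero, LinearMap.zero_apply]
    rw [(hS.polar_base hh _ _).2, norm_smul, hz, Real.norm_eq_abs, mul_one, sq_abs, h33]
    norm_num
  -- Above the critical value `h` is positive along the whole ray, which therefore never leaves `U`.
  · exfalso
    have hb0 : 0 < b := lt_trans (by positivity) hb
    have hin := hmem (Ici 0) isPreconnected_Ici self_mem_Ici fun t ht => by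
      have ht : 0 ≤ t := ht
      rcases ht.eq_or_lt with h0 | h0
      · simp [← h0]
      have h1 : 0 ≤ 1 - t ^ 2 + 2 / (3 * √3) * t ^ 3 := by
        rw [hfac]
        positivity
      have h2 : 2 / (3 * √3) * t ^ 3 < b * t ^ 3 := by gcongr
      linarith
    -- At parameter `t` the reverse Cauchy-Schwarz inequality reduces to `bt - t²/9 - 1/3 ≤ 0`. The
    -- left side is largest at `t = 9b/2`, with value `9b²/4 - 1/3`, positive because `b² > 4/27`.
    have hq := hin (9 * b / 2) (by positivity : (0 : ℝ) ≤ 9 * b / 2)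
    have hcs := hU.polar_mul_le_sq hq (A (0, z))
    have h1 : polar h (A (0, z)) (A (1, 0)) (A (1, 0)) = 0 := (hS.polar_base hh 0 z).1
    have h2 : polar h (A (0, z)) (A (0, z)) (A (1, 0)) = -1 / 3 := by
      rw [(hS.polar_base hh 0 z).2, hz]
      norm_num
    have h4 : polar h (A (0, z)) (A (0, z)) (A (0, z)) = b := by
      rw [hS.polar_diag hh]
      simp [hbdef]
    rw [hline, ← hA, polar_add_smul_sq, polar_add_left, polar_smul_left, h4,
      polar_swap_left h (A (1, 0)) (A (0, z)), polar_swap_right h (A (0, z)) (A (1, 0)), h2,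
      polar_swap_right h (A (1, 0)) (A (1, 0)), polar_swap_left h (A (1, 0)) (A (0, z)), h1] at hcs
    have hb2 : (2 / (3 * √3)) ^ 2 < b ^ 2 := by gcongr
    rw [div_pow, mul_pow, h33] at hb2
    nlinarith

theorem exists_isGreatest (P : MvPolynomial (Fin n) ℝ) (hn : 1 ≤ n) :
    ∃ M : ℝ, IsGreatest ((fun z : EuclideanSpace ℝ (Fin n) =>
      eval (z : Fin n → ℝ) P) '' {z | ‖z‖ = 1}) M := by
  have hs : {z : EuclideanSpace ℝ (Fin n) | ‖z‖ = 1} = Metric.sphere 0 1 := by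
    ext z
    simp
  have hc : Continuous fun z : EuclideanSpace ℝ (Fin n) => eval (z : Fin n → ℝ) P :=
    (MvPolynomial.continuous_eval P).comp (PiLp.continuous_ofLp 2 _)
  rw [hs]
  have : Nonempty (Fin n) := ⟨⟨0, hn⟩⟩
  exact ((isCompact_sphere _ _).image hc).exists_isGreatest
    ((NormedSpace.sphere_nonempty.2 zero_le_one).image _)

theorem hasRegularBoundary_iff (hS : IsStandardForm h H A P) (hn : 1 ≤ n) (hH : IsCCPSR h H) :
    HasRegularBoundary h H ↔ ∃ M : ℝ, IsGreatest ((fun z : EuclideanSpace ℝ (Fin n) =>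
      eval (z : Fin n → ℝ) P) '' {z | ‖z‖ = 1}) M ∧ M < 2 / (3 * √3) := by
  rw [hH.hasRegularBoundary_iff]
  constructor
  · intro hs
    obtain ⟨M, hM⟩ := exists_isGreatest P hn
    refine ⟨M, hM, ?_⟩
    obtain ⟨z, hz, rfl⟩ := hM.1
    by_contra hlt
    exact hs (hS.singular_of_le_eval hH hz (not_lt.1 hlt))
  · rintro ⟨M, hM, hlt⟩ hs
    obtain ⟨z, hz, hb⟩ := hS.exists_eval_eq_of_singular hH hs
    exact (hlt.trans_le hb.ge).not_ge (hM.2 ⟨z, hz, rfl⟩)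

end IsStandardForm

end Manifold

end PSR

theorem mainTheorem3 (n : ℕ) (hn : 1 ≤ n) (h : MvPolynomial (Fin (n + 1)) ℝ)
    (H : Set (Fin (n + 1) → ℝ)) (hH : PSR.IsCCPSR h H) :
    (PSR.HasRegularBoundary h H ↔ ¬ PSR.SingularAtInfinity h H) ∧
    ∀ (A : (ℝ × EuclideanSpace ℝ (Fin n)) ≃ₗ[ℝ] (Fin (n + 1) → ℝ))
      (P : MvPolynomial (Fin n) ℝ), PSR.IsStandardForm h H A P →
      (PSR.HasRegularBoundary h H ↔
        ∃ M : ℝ, IsGreatest ((fun z : EuclideanSpace ℝ (Fin n) =>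
            MvPolynomial.eval (z : Fin n → ℝ) P) '' {z | ‖z‖ = 1}) M ∧
          M < 2 / (3 * √3)) :=
  ⟨hH.hasRegularBoundary_iff, fun _ _ hS => hS.hasRegularBoundary_iff hn hH⟩
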